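/- \textbf{Proposition (four-corners Cantor measure).} Let $T_1,T_2,T_3,T_4$ be the homotheties of the plane of ratio $1/4$ centered at $(0,0)$, $(0,1)$, $(1,1)$, $(1,0)$, and let $\mu_K$ be the natural self-similar measure on the four-corner Cantor set $K$ (the attractor of $(T_1,\dots,T_4)$), that is, the unique Borel probability measure on $[0,1]^2$ with $$\mu_K=\tfrac14 (T_1)_*\mu_K+\tfrac14 (T_2)_*\mu_K+\tfrac14 (T_3)_*\mu_K+\tfrac14 (T_4)_*\mu_K .$$ For probability measures $\mu,\nu$ on $[0,1]^2$ put $$W_{1/2}(\mu,\nu)=\sup_f\Big|\int f\,d\mu-\int f\,d\nu\Big|,$$ the supremum being over all $f:[0,1]^2\to\mathbb{R}$ with $|f(x)-f(y)|\le\|x-y\|^{1/2}$ for all $x,y$, where $\|\cdot\|$ is the Euclidean norm. Let $(X_k)_{k\ge 0}$ be i.i.d. random points of law $\mu_K$ and let $\hat\mu_n=\frac1n\sum_{k=1}^n\delta_{X_k}$. Then $$\mathbb{E}\big[W_{1/2}(\hat\mu_n,\mu_K)\big]\asymp\frac{\log n}{\sqrt n},$$ i.e. there are absolute constants $0<c\le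 C<\infty$ such that for every integer $n\ge 2$ the random variable $W_{1/2}(\hat\mu_n,\mu_K)$ is integrable and $$c\,\frac{\log n}{\sqrt n}\;\le\;\mathbb{E}\big[W_{1/2}(\hat\mu_n,\mu_K)\big]\;\le\; C\,\frac{\log n}{\sqrt n}.$$ -/

import Mathlib

open MeasureTheory ProbabilityTheory
open scoped ENNReal

noncomputable section

namespace FourCorners

/-! ### The unit square and the four homotheties -/

/-- The unit square `[0,1]²` in the Euclidean plane. -/
def unitSquare : Set (EuclideanSpace ℝ (Fin 2)) := {x | ∀ j, x j ∈ Set.Icc (0 : ℝ) 1}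

/-- The four corners `(0,0)`, `(0,1)`, `(1,1)`, `(1,0)` of the unit square. -/
def corner : Fin 4 → EuclideanSpace ℝ (Fin 2) := ![!₂[0, 0], !₂[0, 1], !₂[1, 1], !₂[1, 0]]

lemma corner_mem (i : Fin 4) : corner i ∈ unitSquare := by
  intro j
  fin_cases i <;> fin_cases j <;> simp [corner]

lemma homothety_apply (i : Fin 4) (x : EuclideanSpace ℝ (Fin 2)) :
    AffineMap.homothety (corner i) (1 / 4 : ℝ) x = (3 / 4 : ℝ) • corner i + (1 / 4 : ℝ) • x := by
  rw [AffineMap.homothety_apply, vsub_eq_sub, vadd_eq_add]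
  module

lemma homothety_mem (i : Fin 4) {x : EuclideanSpace ℝ (Fin 2)} (hx : x ∈ unitSquare) :
    AffineMap.homothety (corner i) (1 / 4 : ℝ) x ∈ unitSquare := by
  intro j
  have h1 := corner_mem i j
  have h2 := hx j
  rw [homothety_apply]
  simp only [Set.mem_Icc, PiLp.add_apply, PiLp.smul_apply, smul_eq_mul] at *
  constructor <;> linarith [h1.1, h1.2, h2.1, h2.2]

/-- `T i` is the homothety of ratio `1/4` centered at the `i`-th corner, as a self-map of the
unit square. -/
def T (i : Fin 4) (x : unitSquare) : unitSquare :=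
  ⟨AffineMap.homothety (corner i) (1 / 4 : ℝ) (x : EuclideanSpace ℝ (Fin 2)),
    homothety_mem i x.2⟩

lemma T_coe (i : Fin 4) (x : unitSquare) :
    (T i x : EuclideanSpace ℝ (Fin 2)) = (3 / 4 : ℝ) • corner i + (1 / 4 : ℝ) • x.1 :=
  homothety_apply i x.1

lemma measurable_T (i : Fin 4) : Measurable (T i) := by
  refine Measurable.subtype_mk ?_
  simp only [homothety_apply]
  fun_prop

/-- The operator `ν ↦ ¼ (T₁)_* ν + ¼ (T₂)_* ν + ¼ (T₃)_* ν + ¼ (T₄)_* ν`. -/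
def transfer (ν : Measure unitSquare) : Measure unitSquare :=
  ∑ i : Fin 4, (1 / 4 : ℝ≥0∞) • ν.map (T i)

/-! ### Existence of the fixed probability measure -/

/-- The point of the plane with a given address. -/
def codeAux (w : ℕ → Fin 4) : EuclideanSpace ℝ (Fin 2) :=
  ∑' k, ((1 / 4 : ℝ) ^ k * (3 / 4)) • corner (w k)

lemma hasSum_weights : HasSum (fun k : ℕ => (1 / 4 : ℝ) ^ k * (3 / 4)) 1 := by
  have := (hasSum_geometric_of_lt_one (r := (1 / 4 : ℝ)) (by norm_num) (by norm_num)).mul_right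
    (3 / 4)
  have e : (1 - 1 / 4 : ℝ)⁻¹ * (3 / 4) = 1 := by norm_num
  rwa [e] at this

lemma norm_corner_le (i : Fin 4) : ‖corner i‖ ≤ 2 := by
  rw [EuclideanSpace.norm_eq, Real.sqrt_le_left (by norm_num), Fin.sum_univ_two]
  fin_cases i <;> simp [corner] <;> norm_num

lemma norm_term_le (k : ℕ) (i : Fin 4) :
    ‖((1 / 4 : ℝ) ^ k * (3 / 4)) • corner i‖ ≤ (1 / 4 : ℝ) ^ k * (3 / 4) * 2 := by
  rw [norm_smul, Real.norm_of_nonneg (by positivity)]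
  exact mul_le_mul_of_nonneg_left (norm_corner_le i) (by positivity)

lemma summable_code (w : ℕ → Fin 4) :
    Summable (fun k => ((1 / 4 : ℝ) ^ k * (3 / 4)) • corner (w k)) :=
  Summable.of_norm_bounded (hasSum_weights.summable.mul_right 2) fun k => norm_term_le k (w k)

lemma measurable_codeAux : Measurable codeAux := by
  have h : Continuous codeAux :=
    continuous_tsum (fun k => ((continuous_of_discreteTopology
      (f := fun i : Fin 4 => ((1 / 4 : ℝ) ^ k * (3 / 4)) • corner i)).comp (continuous_apply k)))
      (hasSum_weights.summable.mul_right 2) fun k w => norm_term_le k (w k)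
  exact h.measurable

lemma codeAux_mem (w : ℕ → Fin 4) : codeAux w ∈ unitSquare := by
  intro j
  have h : HasSum (fun k => (1 / 4 : ℝ) ^ k * (3 / 4) * corner (w k) j) (codeAux w j) := by
    have := (summable_code w).hasSum.mapL (EuclideanSpace.proj (𝕜 := ℝ) j)
    exact this
  refine ⟨h.nonneg fun k => ?_, hasSum_le (fun k => ?_) h hasSum_weights⟩
  · have := (corner_mem (w k) j).1
    positivity
  · exact mul_le_of_le_one_right (by positivity) (corner_mem (w k) j).2

/-- The point of the unit square with a given address. -/
def code (w : ℕ → Fin 4) : unitSquare := ⟨codeAux w, codeAux_mem w⟩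

lemma measurable_code : Measurable code := measurable_codeAux.subtype_mk

/-- Adding a first letter to an address. -/
def consWord (i : Fin 4) (w : ℕ → Fin 4) : ℕ → Fin 4 := fun k => Nat.casesOn k i w

lemma measurable_consWord (i : Fin 4) : Measurable (consWord i) := by
  refine measurable_pi_lambda _ fun k => ?_
  cases k with
  | zero => exact measurable_const
  | succ k => exact measurable_pi_apply k

lemma code_consWord (i : Fin 4) (w : ℕ → Fin 4) : code (consWord i w) = T i (code w) := by
  apply Subtype.ext
  rw [T_coe]
  change codeAux (consWord i w) = (3 / 4 : ℝ) • corner i + (1 / 4 : ℝ) • codeAux w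
  rw [codeAux, (summable_code _).tsum_eq_zero_add, codeAux, ← tsum_const_smul'']
  congr 1
  · simp [consWord]
  · refine tsum_congr fun k => ?_
    rw [smul_smul]
    congr 1
    ring

/-- The uniform probability measure on four letters. -/
def unif4 : Measure (Fin 4) := uniformOn Set.univ

instance : IsProbabilityMeasure unif4 := by
  unfold unif4
  infer_instance

lemma unif4_apply (s : Set (Fin 4)) : unif4 s = ∑ i : Fin 4, (1 / 4 : ℝ≥0∞) * s.indicator 1 i := by
  classical
  have h : unif4 = ∑ i : Fin 4, (1 / 4 : ℝ≥0∞) • Measure.dirac i := by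
    refine Measure.ext_of_singleton fun a => ?_
    rw [unif4, uniformOn_univ]
    simp [Set.indicator_apply, eq_comm]
  rw [h]
  simp

/-- The law of an i.i.d. uniform address. -/
def wordMeasure : Measure (ℕ → Fin 4) := Measure.infinitePi fun _ => unif4

instance : IsProbabilityMeasure wordMeasure := by
  unfold wordMeasure
  infer_instance

lemma wordMeasure_eq :
    ∑ i : Fin 4, (1 / 4 : ℝ≥0∞) • wordMeasure.map (consWord i) = wordMeasure := by
  classical
  refine Measure.eq_infinitePi _ fun s t ht => ?_
  set s' : Finset ℕ := (s.erase 0).image Nat.pred with hs'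
  have hpre (i : Fin 4) : consWord i ⁻¹' (Set.pi s t) =
      if 0 ∈ s ∧ i ∉ t 0 then ∅ else Set.pi s' (fun k => t (k + 1)) := by
    ext w
    have h1 : w ∈ consWord i ⁻¹' (Set.pi s t) ↔
        (0 ∈ s → i ∈ t 0) ∧ ∀ k, k + 1 ∈ s → w k ∈ t (k + 1) := by
      constructor
      · exact fun h => ⟨fun h0 => h 0 h0, fun k hk => h (k + 1) hk⟩
      · rintro ⟨h0, h⟩ k hk
        cases k with
        | zero => exact h0 hk
        | succ k => exact h k hk
    have h2 : w ∈ Set.pi (s' : Set ℕ) (fun k => t (k + 1)) ↔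
        ∀ k, k + 1 ∈ s → w k ∈ t (k + 1) := by
      refine forall_congr' fun k => imp_congr_left ?_
      simp only [hs', Finset.coe_image, Set.mem_image, Finset.mem_coe, Finset.mem_erase]
      constructor
      · rintro ⟨m, ⟨hm0, hm⟩, rfl⟩
        rwa [Nat.pred_eq_sub_one, Nat.sub_add_cancel (Nat.pos_of_ne_zero hm0)]
      · exact fun h => ⟨k + 1, ⟨k.succ_ne_zero, h⟩, rfl⟩
    rw [h1]
    split_ifs with hc
    · simp only [Set.mem_empty_iff_false, iff_false]
      exact fun h => hc.2 (h.1 hc.1)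
    · rw [h2]
      push Not at hc
      exact ⟨fun h => h.2, fun h => ⟨hc, h⟩⟩
  have hprod : wordMeasure (Set.pi s' (fun k => t (k + 1))) =
      ∏ k ∈ s.erase 0, unif4 (t k) := by
    rw [wordMeasure, Measure.infinitePi_pi _ (fun k _ => ht _), hs', Finset.prod_image]
    · refine Finset.prod_congr rfl fun k hk => ?_
      rw [Nat.pred_eq_sub_one, Nat.sub_add_cancel (Nat.pos_of_ne_zero (Finset.ne_of_mem_erase hk))]
    · intro a ha b hb hab
      have ha' := Finset.ne_of_mem_erase ha
      have hb' := Finset.ne_of_mem_erase hb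
      simp only [Nat.pred_eq_sub_one] at hab
      omega
  have hmeas : MeasurableSet (Set.pi (s : Set ℕ) t) :=
    MeasurableSet.pi s.countable_toSet fun k _ => ht k
  simp only [Measure.coe_finsetSum, Measure.coe_smul, Finset.sum_apply, Pi.smul_apply,
    smul_eq_mul, Measure.map_apply (measurable_consWord _) hmeas, hpre]
  by_cases h0 : 0 ∈ s
  · rw [← Finset.mul_prod_erase s _ h0, ← hprod, unif4_apply, Finset.sum_mul]
    refine Finset.sum_congr rfl fun i _ => ?_
    by_cases hi : i ∈ t 0 <;> simp [h0, hi]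
  · rw [Finset.erase_eq_of_notMem h0] at hprod
    rw [← hprod]
    simp only [h0, false_and, if_false]
    rw [← Finset.sum_mul]
    have : ∑ _i : Fin 4, (1 / 4 : ℝ≥0∞) = 1 := by
      simp [ENNReal.mul_inv_cancel]
    rw [this, one_mul]

/-! ### Existence and uniqueness of the fixed probability measure -/

lemma exists_fixed : ∃ ν : Measure unitSquare, IsProbabilityMeasure ν ∧ transfer ν = ν := by
  refine ⟨wordMeasure.map code, Measure.isProbabilityMeasure_map measurable_code.aemeasurable, ?_⟩
  have h (i : Fin 4) : (wordMeasure.map code).map (T i) = (wordMeasure.map (consWord i)).map code := by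
    rw [Measure.map_map (measurable_T i) measurable_code,
      Measure.map_map measurable_code (measurable_consWord i)]
    congr 1
    funext w
    exact (code_consWord i w).symm
  conv_rhs => rw [← wordMeasure_eq]
  simp only [transfer, h]
  rw [← Measure.mapₗ_apply_of_measurable measurable_code, map_sum]
  simp only [Measure.map_smul, Measure.mapₗ_apply_of_measurable measurable_code]

/-- The characteristic function of a measure on the unit square. -/
def cf (ν : Measure unitSquare) (t : EuclideanSpace ℝ (Fin 2)) : ℂ :=
  charFun (ν.map (Subtype.val : unitSquare → EuclideanSpace ℝ (Fin 2))) t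

lemma cf_eq (ν : Measure unitSquare) (t : EuclideanSpace ℝ (Fin 2)) :
    cf ν t = ∫ x : unitSquare, Complex.exp (inner ℝ x.1 t * Complex.I) ∂ν := by
  rw [cf, charFun_apply, integral_map measurable_subtype_coe.aemeasurable]
  exact (by fun_prop : Continuous _).aestronglyMeasurable

lemma cf_transfer (ν : Measure unitSquare) [IsProbabilityMeasure ν]
    (t : EuclideanSpace ℝ (Fin 2)) :
    cf (transfer ν) t = ∑ i : Fin 4, (1 / 4 : ℂ) *
      (Complex.exp (inner ℝ ((3 / 4 : ℝ) • corner i) t * Complex.I) * cf ν ((1 / 4 : ℝ) • t)) := by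
  have hc : Continuous fun x : unitSquare => Complex.exp (inner ℝ x.1 t * Complex.I) := by fun_prop
  have hint (m : Measure unitSquare) [IsFiniteMeasure m] :
      Integrable (fun x : unitSquare => Complex.exp (inner ℝ x.1 t * Complex.I)) m :=
    Integrable.of_bound hc.aestronglyMeasurable 1 (Filter.Eventually.of_forall fun x => by
      rw [Complex.norm_exp_ofReal_mul_I])
  rw [cf_eq, transfer, integral_finsetSum_measure]
  · refine Finset.sum_congr rfl fun i _ => ?_
    rw [integral_smul_measure, integral_map (measurable_T i).aemeasurable
      hc.aestronglyMeasurable, cf_eq, ← integral_const_mul]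
    simp only [T_coe, inner_add_left, Complex.ofReal_add, add_mul, Complex.exp_add]
    rw [Complex.real_smul]
    congr 1
    · simp
    · refine integral_congr_ae (Filter.Eventually.of_forall fun x => ?_)
      simp [real_inner_smul_left, real_inner_smul_right]
  · intro i _
    exact (hint _).smul_measure (by simp)

lemma fixed_unique {μ ν : Measure unitSquare} [IsProbabilityMeasure μ] [IsProbabilityMeasure ν]
    (hμ : transfer μ = μ) (hν : transfer ν = ν) : μ = ν := by
  have step (t : EuclideanSpace ℝ (Fin 2)) :
      ‖cf μ t - cf ν t‖ ≤ ‖cf μ ((1 / 4 : ℝ) • t) - cf ν ((1 / 4 : ℝ) • t)‖ := by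
    have e : cf μ t - cf ν t = ∑ i : Fin 4, (1 / 4 : ℂ) *
        (Complex.exp (inner ℝ ((3 / 4 : ℝ) • corner i) t * Complex.I) *
          (cf μ ((1 / 4 : ℝ) • t) - cf ν ((1 / 4 : ℝ) • t))) := by
      conv_lhs => rw [← hμ, ← hν, cf_transfer, cf_transfer, ← Finset.sum_sub_distrib]
      exact Finset.sum_congr rfl fun i _ => by ring
    rw [e]
    refine (norm_sum_le _ _).trans ?_
    simp only [norm_mul, Complex.norm_exp_ofReal_mul_I, one_mul]
    rw [Finset.sum_const]
    simp
  have iter (t : EuclideanSpace ℝ (Fin 2)) (n : ℕ) :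
      ‖cf μ t - cf ν t‖ ≤ ‖cf μ (((1 / 4 : ℝ) ^ n) • t) - cf ν (((1 / 4 : ℝ) ^ n) • t)‖ := by
    induction n with
    | zero => simp
    | succ n ih =>
      refine ih.trans ((step _).trans (le_of_eq ?_))
      rw [smul_smul, ← pow_succ']
  have cont (m : Measure unitSquare) [IsProbabilityMeasure m] : Continuous (cf m) := by
    have : cf m = fun t => ∫ x : unitSquare, Complex.exp (inner ℝ x.1 t * Complex.I) ∂m :=
      funext (cf_eq m)
    rw [this]
    refine continuous_of_dominated (bound := fun _ => 1)
      (fun t => (by fun_prop : Continuous _).aestronglyMeasurable) (fun t => ?_)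
      (integrable_const _) (Filter.Eventually.of_forall fun x => by fun_prop)
    exact Filter.Eventually.of_forall fun x => by rw [Complex.norm_exp_ofReal_mul_I]
  have hcf (t : EuclideanSpace ℝ (Fin 2)) : cf μ t = cf ν t := by
    have h0 : Filter.Tendsto (fun n : ℕ => ((1 / 4 : ℝ) ^ n) • t) Filter.atTop (nhds 0) := by
      have := (tendsto_pow_atTop_nhds_zero_of_lt_one (r := (1 / 4 : ℝ)) (by norm_num)
        (by norm_num)).smul_const t
      simpa only [zero_smul] using this
    have hl := (((cont μ).sub (cont ν)).norm.tendsto 0).comp h0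
    have hz : ‖cf μ 0 - cf ν 0‖ = 0 := by simp [cf_eq]
    rw [Pi.sub_apply, hz] at hl
    have := ge_of_tendsto' hl (iter t)
    exact sub_eq_zero.1 (norm_le_zero_iff.1 this)
  have hs : MeasurableSet unitSquare := by
    have : unitSquare = ⋂ j, {x : EuclideanSpace ℝ (Fin 2) | x j ∈ Set.Icc (0 : ℝ) 1} := by
      ext x
      simp [unitSquare]
    rw [this]
    exact MeasurableSet.iInter fun j => (by fun_prop :
      Measurable fun x : EuclideanSpace ℝ (Fin 2) => x j) measurableSet_Icc
  have emb := MeasurableEmbedding.subtype_coe hs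
  have p1 := Measure.isProbabilityMeasure_map (μ := μ) emb.measurable.aemeasurable
  have p2 := Measure.isProbabilityMeasure_map (μ := ν) emb.measurable.aemeasurable
  have := Measure.ext_of_charFun (funext hcf)
  rw [← emb.comap_map μ, ← emb.comap_map ν, this]

/-- There is exactly one probability measure on the unit square that is fixed by `transfer`. -/
theorem existsUnique_fixed :
    ∃! ν : Measure unitSquare, IsProbabilityMeasure ν ∧ transfer ν = ν := by
  obtain ⟨ν, hν, h⟩ := exists_fixed
  exact ⟨ν, ⟨hν, h⟩, fun m hm => by
    have := hm.1
    exact fixed_unique hm.2 h⟩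

/-- The natural measure on the four-corner Cantor set: the unique probability measure on the
unit square that is a fixed point of `transfer`. -/
def cantorMeasure : Measure unitSquare := existsUnique_fixed.choose

instance : IsProbabilityMeasure cantorMeasure := existsUnique_fixed.choose_spec.1.1

theorem transfer_cantorMeasure : transfer cantorMeasure = cantorMeasure :=
  existsUnique_fixed.choose_spec.1.2

theorem eq_cantorMeasure {ν : Measure unitSquare} (h : IsProbabilityMeasure ν)
    (hν : transfer ν = ν) : ν = cantorMeasure :=
  existsUnique_fixed.choose_spec.2 ν ⟨h, hν⟩

/-! ### The Wasserstein distance and the empirical measure -/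

/-- The real functions `f` on the unit square with `|f x - f y| ≤ ‖x - y‖ ^ q` for all `x`, `y`,
where `‖·‖` is the Euclidean norm. -/
def Hol (q : ℝ) : Set (unitSquare → ℝ) :=
  {f | ∀ x y : unitSquare, |f x - f y| ≤ ‖(x : EuclideanSpace ℝ (Fin 2)) - y‖ ^ q}

/-- The `q`-Wasserstein distance of two measures on the unit square, in its dual form.
For `q ∈ (0, 1]` and probability measures, `f` is continuous and bounded up to a constant, so that
the integrals are defined and the supremum is that of a nonempty bounded set. -/
def W (q : ℝ) (μ ν : Measure unitSquare) : ℝ :=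
  ⨆ f : Hol q, |∫ x, f.1 x ∂μ - ∫ x, f.1 x ∂ν|

/-- The empirical measure of the points `x 1, …, x n`. -/
def empirical (n : ℕ) (x : ℕ → unitSquare) : Measure unitSquare :=
  (n : ℝ≥0∞)⁻¹ • ∑ k ∈ Finset.Icc 1 n, Measure.dirac (x k)

end FourCorners

end

/-!
The cylinders of level `k` of the four-corner Cantor set have mass `4⁻ᵏ` and, in the plane, diameter
and mutual distances comparable to `4⁻ᵏ`. Approximating a `q`-Hölder test function by its values at
one point of each cylinder and telescoping over the levels bounds `W q` above by the sum over `k` of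
`4^(-q k)` times the total deviation of the level-`k` cylinder masses. Conversely, adding up over
the levels multiples of size `4^(-q k)` of the signs of these deviations gives an admissible test
function, because two points of the Cantor set separate at a definite scale, so the same sum is also
a lower bound. For the empirical measure of `n` points each level-`k` cylinder mass deviates by
about `2⁻ᵏ / √n` as long as `4ᵏ ≲ n` (the lower bound compares second and fourth moments), so level
`k` contributes `4^(-q k) * 2ᵏ / √n`. The exponent `q = 1/2` is critical: each of the `≈ log₄ n`
levels contributes `1 / √n`.
-/

namespace FourCorners

section Moments

variable {Ω : Type*} [MeasurableSpace Ω] {P : Measure Ω}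

lemma integrable_pow_of_memLp [IsFiniteMeasure P] {f : Ω → ℝ} {k n : ℕ} (hf : MemLp f n P)
    (hk : k ≤ n) : Integrable (fun ω => f ω ^ k) P :=
  have hfk : MemLp f k P := hf.mono_exponent (mod_cast hk)
  hfk.integrable_norm_pow'.mono' (hf.1.pow k) (.of_forall fun ω => (norm_pow (f ω) k).le)

lemma integral_add_pow_of_indepFun [IsFiniteMeasure P] {f g : Ω → ℝ} {n : ℕ}
    (hfg : IndepFun f g P) (hf : MemLp f n P) (hg : MemLp g n P) :
    ∫ ω, (f ω + g ω) ^ n ∂P =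
      ∑ k ∈ Finset.range (n + 1), (∫ ω, f ω ^ k ∂P) * (∫ ω, g ω ^ (n - k) ∂P) * n.choose k := by
  have hint (k : ℕ) (hk : k ∈ Finset.range (n + 1)) :
      Integrable (fun ω => f ω ^ k * g ω ^ (n - k) * n.choose k) P :=
    ((hfg.comp (measurable_id.pow_const k) (measurable_id.pow_const (n - k))).integrable_mul
      (integrable_pow_of_memLp hf (Finset.mem_range_succ_iff.mp hk))
      (integrable_pow_of_memLp hg (n.sub_le k))).mul_const _
  simp only [add_pow]
  rw [integral_finsetSum _ hint]
  refine Finset.sum_congr rfl fun k _ => ?_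
  rw [integral_mul_const, hfg.integral_fun_comp_mul_comp (f := (· ^ k)) (g := (· ^ (n - k)))
    hf.1.aemeasurable hg.1.aemeasurable (by fun_prop) (by fun_prop)]

lemma integral_add_pow_four_of_indepFun [IsProbabilityMeasure P] {f g : Ω → ℝ}
    (hfg : IndepFun f g P) (hf : MemLp f 4 P) (hg : MemLp g 4 P)
    (hf₀ : ∫ ω, f ω ∂P = 0) (hg₀ : ∫ ω, g ω ∂P = 0) :
    ∫ ω, (f ω + g ω) ^ 4 ∂P =
      ∫ ω, f ω ^ 4 ∂P + 6 * (∫ ω, f ω ^ 2 ∂P) * (∫ ω, g ω ^ 2 ∂P) + ∫ ω, g ω ^ 4 ∂P := by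
  rw [integral_add_pow_of_indepFun hfg (mod_cast hf) (mod_cast hg)]
  simp only [Finset.sum_range_succ, Finset.sum_range_zero, Nat.choose, pow_zero, pow_one,
    integral_const, probReal_univ, hf₀, hg₀, one_smul, Nat.sub_zero, Nat.reduceSub]
  ring

lemma integral_sq_sum_of_pairwise_indepFun [IsProbabilityMeasure P] {ι : Type*} {Z : ι → Ω → ℝ}
    {s : Finset ι} (hZ : ∀ i ∈ s, MemLp (Z i) 2 P)
    (hind : Set.Pairwise ↑s fun i j => IndepFun (Z i) (Z j) P)
    (h₀ : ∀ i ∈ s, ∫ ω, Z i ω ∂P = 0) :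
    ∫ ω, (∑ i ∈ s, Z i ω) ^ 2 ∂P = ∑ i ∈ s, ∫ ω, Z i ω ^ 2 ∂P := by
  have hS₀ : ∫ ω, (∑ i ∈ s, Z i) ω ∂P = 0 := by
    simp only [Finset.sum_apply]
    rw [integral_finsetSum _ fun i hi => (hZ i hi).integrable one_le_two, Finset.sum_eq_zero h₀]
  have hvar := IndepFun.variance_sum hZ hind
  rw [variance_of_integral_eq_zero (memLp_finsetSum' s hZ).aemeasurable hS₀] at hvar
  simp only [Finset.sum_apply] at hvar
  rw [hvar]
  exact Finset.sum_congr rfl fun i hi =>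
    variance_of_integral_eq_zero (hZ i hi).aemeasurable (h₀ i hi)

lemma integral_pow_four_sum_le_of_iIndepFun [IsProbabilityMeasure P] {ι : Type*} {Z : ι → Ω → ℝ}
    (hZ : ∀ i, MemLp (Z i) 4 P) (hind : iIndepFun Z P) (h₀ : ∀ i, ∫ ω, Z i ω ∂P = 0)
    (s : Finset ι) :
    ∫ ω, (∑ i ∈ s, Z i ω) ^ 4 ∂P ≤
      ∑ i ∈ s, ∫ ω, Z i ω ^ 4 ∂P + 3 * (∑ i ∈ s, ∫ ω, Z i ω ^ 2 ∂P) ^ 2 := by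
  classical
  induction s using Finset.induction_on with
  | empty => simp
  | insert i s hi ih =>
    have hS₀ : ∫ ω, ∑ j ∈ s, Z j ω ∂P = 0 := by
      rw [integral_finsetSum _ fun j _ => (hZ j).integrable (by norm_num),
        Finset.sum_eq_zero fun j _ => h₀ j]
    have hindS : IndepFun (Z i) (fun ω => ∑ j ∈ s, Z j ω) P := by
      simpa only [Finset.sum_fn] using
        (hind.indepFun_finsetSum_of_notMem₀ (fun j => (hZ j).aemeasurable) hi).symm
    have hS₂ : ∫ ω, (∑ j ∈ s, Z j ω) ^ 2 ∂P = ∑ j ∈ s, ∫ ω, Z j ω ^ 2 ∂P :=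
      integral_sq_sum_of_pairwise_indepFun (fun j _ => (hZ j).mono_exponent (by norm_num))
        (fun j _ l _ hjl => hind.indepFun hjl) fun j _ => h₀ j
    simp only [Finset.sum_insert hi]
    rw [integral_add_pow_four_of_indepFun hindS (hZ i) (memLp_finsetSum s fun j _ => hZ j) (h₀ i)
      hS₀, hS₂]
    linarith [sq_nonneg (∫ ω, Z i ω ^ 2 ∂P)]

lemma sq_integral_abs_le_integral_sq [IsProbabilityMeasure P] {f : Ω → ℝ} (hf : MemLp f 2 P) :
    (∫ ω, |f ω| ∂P) ^ 2 ≤ ∫ ω, f ω ^ 2 ∂P := by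
  have hvar := variance_nonneg (fun ω => |f ω|) P
  rw [variance_eq_sub (X := fun ω => |f ω|) hf.abs] at hvar
  simpa only [Pi.pow_apply, sq_abs, sub_nonneg] using hvar

/- Hölder's inequality for `f² = |f| ^ (2 / 3) * |f| ^ (4 / 3)` with exponents `3 / 2` and `3`. -/
lemma integral_sq_pow_three_le {f : Ω → ℝ} (hf : Integrable f P)
    (hf₄ : Integrable (fun ω => f ω ^ 4) P) :
    (∫ ω, f ω ^ 2 ∂P) ^ 3 ≤ (∫ ω, |f ω| ∂P) ^ 2 * ∫ ω, f ω ^ 4 ∂P := by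
  have hrpow (x a p : ℝ) : (|x| ^ a) ^ p = |x| ^ (a * p) := (Real.rpow_mul (abs_nonneg x) a p).symm
  have habs₄ (x : ℝ) : |x| ^ 4 = x ^ 4 := Even.pow_abs ⟨2, rfl⟩ x
  have hmemLp {a p : ℝ} (hp : 0 < p) (hint : Integrable (fun ω => |f ω| ^ (a * p)) P) :
      MemLp (fun ω => |f ω| ^ a) (ENNReal.ofReal p) P := by
    have hmeas : AEStronglyMeasurable (fun ω => |f ω| ^ a) P :=
      (hf.aemeasurable.abs.pow_const a).aestronglyMeasurable
    rw [← integrable_norm_rpow_iff hmeas (by simpa using hp) ENNReal.ofReal_ne_top,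
      ENNReal.toReal_ofReal hp.le]
    simpa only [Real.norm_eq_abs, abs_of_nonneg (Real.rpow_nonneg (abs_nonneg _) _), hrpow]
      using hint
  have hsq (x : ℝ) : |x| ^ (2 / 3 : ℝ) * |x| ^ (4 / 3 : ℝ) = x ^ 2 := by
    rw [← Real.rpow_add' (abs_nonneg x) (by norm_num), ← sq_abs]
    norm_num
  have hHolder :
      ∫ ω, f ω ^ 2 ∂P ≤ (∫ ω, |f ω| ∂P) ^ (2 / 3 : ℝ) * (∫ ω, f ω ^ 4 ∂P) ^ (1 / 3 : ℝ) := by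
    have h := integral_mul_le_Lp_mul_Lq_of_nonneg (μ := P)
      (Real.holderConjugate_iff.mpr ⟨by norm_num, by norm_num⟩ : (3 / 2 : ℝ).HolderConjugate 3)
      (.of_forall fun ω => Real.rpow_nonneg (abs_nonneg (f ω)) (2 / 3))
      (.of_forall fun ω => Real.rpow_nonneg (abs_nonneg (f ω)) (4 / 3))
      (hmemLp (by norm_num) (by norm_num [hf.abs]))
      (hmemLp (by norm_num) (by norm_num [habs₄, hf₄]))
    norm_num [hrpow, hsq, habs₄] at h
    exact h
  have hA : 0 ≤ ∫ ω, |f ω| ∂P := integral_nonneg fun ω => abs_nonneg _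
  have hB : 0 ≤ ∫ ω, f ω ^ 4 ∂P := integral_nonneg fun ω => Even.pow_nonneg ⟨2, rfl⟩ _
  refine (pow_le_pow_left₀ (integral_nonneg fun ω => sq_nonneg _) hHolder 3).trans_eq ?_
  rw [mul_pow, ← Real.rpow_mul_natCast hA, ← Real.rpow_mul_natCast hB]
  norm_num

lemma sq_sum_integral_sq_le [IsProbabilityMeasure P] {ι : Type*} {Z : ι → Ω → ℝ}
    (hZ : ∀ i, AEMeasurable (Z i) P) (hZ₁ : ∀ i, ∀ᵐ ω ∂P, |Z i ω| ≤ 1) (hind : iIndepFun Z P)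
    (h₀ : ∀ i, ∫ ω, Z i ω ∂P = 0) (s : Finset ι) :
    (∑ i ∈ s, ∫ ω, Z i ω ^ 2 ∂P) ^ 2 ≤
      (1 + 3 * ∑ i ∈ s, ∫ ω, Z i ω ^ 2 ∂P) * (∫ ω, |∑ i ∈ s, Z i ω| ∂P) ^ 2 := by
  have hmem (i : ι) (p : ℝ≥0∞) : MemLp (Z i) p P :=
    MemLp.of_bound (hZ i).aestronglyMeasurable 1 (hZ₁ i)
  have hS : MemLp (fun ω => ∑ i ∈ s, Z i ω) (4 : ℕ) P := memLp_finsetSum s fun i _ => hmem i _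
  set V := ∑ i ∈ s, ∫ ω, Z i ω ^ 2 ∂P
  set A := ∫ ω, |∑ i ∈ s, Z i ω| ∂P
  have hV : 0 ≤ V := Finset.sum_nonneg fun i _ => integral_nonneg fun ω => sq_nonneg _
  have hS₂ : ∫ ω, (∑ i ∈ s, Z i ω) ^ 2 ∂P = V :=
    integral_sq_sum_of_pairwise_indepFun (fun i _ => hmem i 2)
      (fun i _ j _ hij => hind.indepFun hij) fun i _ => h₀ i
  have hZ₄ (i : ι) : ∫ ω, Z i ω ^ 4 ∂P ≤ ∫ ω, Z i ω ^ 2 ∂P := by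
    refine integral_mono_ae (integrable_pow_of_memLp (hmem i (4 : ℕ)) le_rfl)
      (integrable_pow_of_memLp (hmem i (2 : ℕ)) le_rfl) ?_
    filter_upwards [hZ₁ i] with ω hω
    nlinarith [sq_nonneg (Z i ω), (sq_le_one_iff_abs_le_one (Z i ω)).mpr hω]
  have hS₄ : ∫ ω, (∑ i ∈ s, Z i ω) ^ 4 ∂P ≤ V + 3 * V ^ 2 :=
    (integral_pow_four_sum_le_of_iIndepFun (fun i => hmem i 4) hind h₀ s).trans
      (add_le_add_left (Finset.sum_le_sum fun i _ => hZ₄ i) _)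
  have hcube : V ^ 3 ≤ A ^ 2 * (V + 3 * V ^ 2) := by
    rw [← hS₂]
    refine (integral_sq_pow_three_le (hS.integrable (by norm_num))
      (integrable_pow_of_memLp hS le_rfl)).trans ?_
    rw [hS₂]
    gcongr
  rcases hV.eq_or_lt with hV₀ | hV₀
  · rw [← hV₀]
    simpa using sq_nonneg A
  · exact le_of_mul_le_mul_left (by linarith) hV₀

end Moments

section Hoelder

lemma dist_le_two (x y : unitSquare) : dist x y ≤ 2 := by
  have hcoord (j : Fin 2) : dist (x.1 j) (y.1 j) ^ 2 ≤ 1 :=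
    pow_le_one₀ dist_nonneg (Real.dist_le_of_mem_Icc_01 (x.2 j) (y.2 j))
  rw [Subtype.dist_eq, EuclideanSpace.dist_eq, Real.sqrt_le_left (by norm_num), Fin.sum_univ_two]
  linarith [hcoord 0, hcoord 1]

variable {q : ℝ} {f : unitSquare → ℝ} {μ ν : Measure unitSquare}

lemma mem_Hol : f ∈ Hol q ↔ ∀ x y, |f x - f y| ≤ dist x y ^ q := by
  simp only [Hol, Set.mem_ofPred_eq, Subtype.dist_eq, dist_eq_norm]

lemma abs_sub_le_of_mem_Hol (hq : 0 ≤ q) (hf : f ∈ Hol q) (x y : unitSquare) :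
    |f x - f y| ≤ 2 ^ q :=
  (mem_Hol.mp hf x y).trans (Real.rpow_le_rpow dist_nonneg (dist_le_two x y) hq)

lemma tendsto_dist_rpow {α : Type*} [PseudoMetricSpace α] (hq : 0 < q) (y : α) :
    Filter.Tendsto (fun x => dist x y ^ q) (nhds y) (nhds 0) := by
  have hcont : Continuous fun x => dist x y ^ q :=
    (Real.continuous_rpow_const hq.le).comp (continuous_id.dist continuous_const)
  simpa only [dist_self, Real.zero_rpow hq.ne'] using hcont.tendsto y

lemma continuous_of_mem_Hol (hq : 0 < q) (hf : f ∈ Hol q) : Continuous f :=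
  continuous_iff_continuousAt.mpr fun y => tendsto_iff_dist_tendsto_zero.mpr <|
    squeeze_zero (fun _ => dist_nonneg) (fun x => mem_Hol.mp hf x y) (tendsto_dist_rpow hq y)

lemma integrable_of_mem_Hol [IsFiniteMeasure ν] (hq : 0 < q) (hf : f ∈ Hol q) :
    Integrable f ν := by
  have x₀ : unitSquare := code fun _ => 0
  refine Integrable.of_bound (continuous_of_mem_Hol hq hf).aestronglyMeasurable (|f x₀| + 2 ^ q)
    (.of_forall fun x => ?_)
  rw [Real.norm_eq_abs]
  linarith [abs_sub_le_of_mem_Hol hq.le hf x x₀, abs_sub_abs_le_abs_sub (f x) (f x₀)]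

lemma abs_integral_sub_integral_le {α : Type*} [MeasurableSpace α] {μ ν : Measure α}
    [IsProbabilityMeasure μ] [IsProbabilityMeasure ν] {g : α → ℝ} {D : ℝ} (hμ : Integrable g μ)
    (hν : Integrable g ν) (hD : ∀ x y, |g x - g y| ≤ D) :
    |∫ x, g x ∂μ - ∫ x, g x ∂ν| ≤ D := by
  have hmean (x : α) : |g x - ∫ y, g y ∂ν| ≤ D := by
    have hsub : g x - ∫ y, g y ∂ν = ∫ y, (g x - g y) ∂ν := by
      rw [integral_sub (integrable_const _) hν, integral_const, probReal_univ, one_smul]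
    rw [hsub, ← Real.norm_eq_abs]
    simpa only [probReal_univ, mul_one] using
      norm_integral_le_of_norm_le_const (.of_forall (hD x)) (μ := ν)
  have hsub : ∫ x, g x ∂μ - ∫ y, g y ∂ν = ∫ x, (g x - ∫ y, g y ∂ν) ∂μ := by
    rw [integral_sub hμ (integrable_const _), integral_const, probReal_univ, one_smul]
  rw [hsub, ← Real.norm_eq_abs]
  simpa only [probReal_univ, mul_one] using
    norm_integral_le_of_norm_le_const (.of_forall hmean) (μ := μ)

section Wasserstein

lemma W_nonneg : 0 ≤ W q μ ν := Real.iSup_nonneg fun _ => abs_nonneg _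

lemma W_comm : W q μ ν = W q ν μ := by simp only [W, abs_sub_comm]

lemma W_le {B : ℝ} (h : ∀ f ∈ Hol q, |∫ x, f x ∂μ - ∫ x, f x ∂ν| ≤ B) : W q μ ν ≤ B := by
  have hzero : (fun _ => 0) ∈ Hol q :=
    mem_Hol.mpr fun x y => by simpa using Real.rpow_nonneg dist_nonneg q
  have : Nonempty (Hol q) := ⟨⟨_, hzero⟩⟩
  exact ciSup_le fun f => h f.1 f.2

variable [IsProbabilityMeasure μ] [IsProbabilityMeasure ν]

lemma abs_integral_sub_integral_le_two_rpow (hq : 0 < q) (hf : f ∈ Hol q) :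
    |∫ x, f x ∂μ - ∫ x, f x ∂ν| ≤ 2 ^ q :=
  abs_integral_sub_integral_le (integrable_of_mem_Hol hq hf) (integrable_of_mem_Hol hq hf)
    (abs_sub_le_of_mem_Hol hq.le hf)

lemma abs_integral_sub_integral_le_W (hq : 0 < q) (hf : f ∈ Hol q) :
    |∫ x, f x ∂μ - ∫ x, f x ∂ν| ≤ W q μ ν :=
  le_ciSup (f := fun g : Hol q => |∫ x, g.1 x ∂μ - ∫ x, g.1 x ∂ν|)
    ⟨2 ^ q, Set.forall_mem_range.mpr fun g => abs_integral_sub_integral_le_two_rpow hq g.2⟩ ⟨f, hf⟩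

lemma W_le_two_rpow (hq : 0 < q) : W q μ ν ≤ 2 ^ q :=
  W_le fun _ hf => abs_integral_sub_integral_le_two_rpow hq hf

lemma W_triangle (hq : 0 < q) {ρ : Measure unitSquare} [IsProbabilityMeasure ρ] :
    W q μ ρ ≤ W q μ ν + W q ν ρ :=
  W_le fun _ hf => (abs_sub_le _ _ _).trans
    (add_le_add (abs_integral_sub_integral_le_W hq hf) (abs_integral_sub_integral_le_W hq hf))

end Wasserstein

/- McShane's extension theorem for the metric `dist ^ q`. -/
lemma exists_mem_Hol_eqOn (hq₀ : 0 < q) (hq₁ : q ≤ 1) {s : Set unitSquare}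
    (hf : ∀ x ∈ s, ∀ y ∈ s, |f x - f y| ≤ dist x y ^ q) : ∃ g ∈ Hol q, Set.EqOn f g s := by
  let e : Metric.Snowflaking unitSquare q hq₀ hq₁ ≃ unitSquare := Metric.Snowflaking.ofSnowflaking
  have hdist (x y) : dist x y = dist (e x) (e y) ^ q :=
    Metric.Snowflaking.dist_toSnowflaking_toSnowflaking (e x) (e y)
  have hLip : LipschitzOnWith 1 (f ∘ e) (e ⁻¹' s) := .of_dist_le_mul fun x hx y hy => by
    rw [NNReal.coe_one, one_mul, hdist]
    exact hf (e x) hx (e y) hy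
  obtain ⟨g, hg, hfg⟩ := hLip.extend_real
  refine ⟨g ∘ e.symm, mem_Hol.mpr fun x y => ?_, fun x hx => ?_⟩
  · have hxy := hg.dist_le_mul (e.symm x) (e.symm y)
    rwa [NNReal.coe_one, one_mul, hdist, e.apply_symm_apply, e.apply_symm_apply] at hxy
  · have hx' := hfg (x := e.symm x) (by rwa [Set.mem_preimage, e.apply_symm_apply])
    rwa [Function.comp_apply, e.apply_symm_apply] at hx'

end Hoelder

section Coding

lemma T_coe_apply (i : Fin 4) (x : unitSquare) (j : Fin 2) :
    (T i x).1 j = 3 / 4 * corner i j + 1 / 4 * x.1 j := by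
  simp only [T_coe, PiLp.add_apply, PiLp.smul_apply, smul_eq_mul]

lemma dist_T (i : Fin 4) (x y : unitSquare) : dist (T i x) (T i y) = 1 / 4 * dist x y := by
  rw [Subtype.dist_eq, Subtype.dist_eq, T_coe, T_coe, dist_add_left, dist_smul₀,
    Real.norm_of_nonneg (by norm_num)]

lemma exists_one_le_abs_corner_sub {i i' : Fin 4} (hi : i ≠ i') :
    ∃ j, 1 ≤ |corner i j - corner i' j| := by
  revert hi
  fin_cases i <;> fin_cases i' <;> simp [corner, Fin.exists_fin_two]

lemma half_le_dist_T {i i' : Fin 4} (hi : i ≠ i') (x y : unitSquare) :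
    1 / 2 ≤ dist (T i x) (T i' y) := by
  obtain ⟨j, hj⟩ := exists_one_le_abs_corner_sub hi
  have hxy : |x.1 j - y.1 j| ≤ 1 := Real.dist_le_of_mem_Icc_01 (x.2 j) (y.2 j)
  calc
    1 / 2 ≤ |(T i x).1 j - (T i' y).1 j| := by
      rw [T_coe_apply, T_coe_apply, le_abs]
      rw [abs_le] at hxy
      rcases le_abs.mp hj with h | h
      · exact .inl (by linarith)
      · exact .inr (by linarith)
    _ ≤ dist (T i x) (T i' y) := by
      rw [Subtype.dist_eq, dist_eq_norm]
      exact PiLp.norm_apply_le ((T i x).1 - (T i' y).1) j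

lemma code_eq_T (w : ℕ → Fin 4) : code w = T (w 0) (code fun k => w (k + 1)) := by
  rw [← code_consWord]
  congr 1
  funext k
  cases k <;> rfl

lemma dist_code_le {w w' : ℕ → Fin 4} {k : ℕ} (h : ∀ j < k, w j = w' j) :
    dist (code w) (code w') ≤ 2 * (1 / 4) ^ k := by
  induction k generalizing w w' with
  | zero => simpa using dist_le_two _ _
  | succ k ih =>
    rw [code_eq_T w, code_eq_T w', ← h 0 k.succ_pos, dist_T, pow_succ]
    linarith [ih (w := fun j => w (j + 1)) (w' := fun j => w' (j + 1))
      fun j hj => h (j + 1) (Nat.succ_lt_succ hj)]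

lemma le_dist_code {w w' : ℕ → Fin 4} {k : ℕ} (h : ∀ j < k, w j = w' j) (hk : w k ≠ w' k) :
    1 / 2 * (1 / 4) ^ k ≤ dist (code w) (code w') := by
  induction k generalizing w w' with
  | zero =>
    rw [code_eq_T w, code_eq_T w', pow_zero, mul_one]
    exact half_le_dist_T hk _ _
  | succ k ih =>
    rw [code_eq_T w, code_eq_T w', ← h 0 k.succ_pos, dist_T, pow_succ]
    linarith [ih (w := fun j => w (j + 1)) (w' := fun j => w' (j + 1))
      (fun j hj => h (j + 1) (Nat.succ_lt_succ hj)) hk]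

lemma code_injective : Function.Injective code := fun w w' h => by
  by_contra hw
  have hdist := le_dist_code (fun j => PiNat.apply_eq_of_lt_firstDiff)
    (PiNat.apply_firstDiff_ne hw)
  rw [h, dist_self] at hdist
  exact hdist.not_gt (by positivity)

lemma measurableEmbedding_code : MeasurableEmbedding code :=
  measurable_code.measurableEmbedding code_injective

/-- The four-corner Cantor set, as the set of points that have an address. -/
def cantorSet : Set unitSquare := Set.range code

lemma measurableSet_cantorSet : MeasurableSet cantorSet :=
  measurableEmbedding_code.measurableSet_range

/-- The address of a point of the Cantor set: a measurable left inverse of `code`, with junk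
values outside the Cantor set. -/
noncomputable def address : unitSquare → ℕ → Fin 4 := measurableEmbedding_code.invFun

lemma measurable_address : Measurable address := measurableEmbedding_code.measurable_invFun

lemma address_code (w : ℕ → Fin 4) : address (code w) = w :=
  measurableEmbedding_code.leftInverse_invFun w

lemma code_address {x : unitSquare} (hx : x ∈ cantorSet) : code (address x) = x := by
  obtain ⟨w, rfl⟩ := hx
  rw [address_code]

/-- The first `k` letters of the address of a point; its fibres are the cylinders of level `k`. -/
noncomputable def addrPrefix (k : ℕ) (x : unitSquare) : Fin k → Fin 4 := fun j => address x j

lemma measurable_addrPrefix (k : ℕ) : Measurable (addrPrefix k) :=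
  measurable_pi_lambda _ fun j => (measurable_pi_apply (j : ℕ)).comp measurable_address

lemma addrPrefix_eq_iff {k : ℕ} {x y : unitSquare} :
    addrPrefix k x = addrPrefix k y ↔ ∀ j < k, address x j = address y j := by
  simp only [funext_iff, addrPrefix, Fin.forall_iff]

lemma exists_addrPrefix_eq_and_le_dist {x y : unitSquare} (hx : x ∈ cantorSet) (hy : y ∈ cantorSet)
    (hxy : x ≠ y) : ∃ k, addrPrefix k x = addrPrefix k y ∧ 1 / 2 * (1 / 4) ^ k ≤ dist x y := by
  obtain ⟨w, rfl⟩ := hx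
  obtain ⟨w', rfl⟩ := hy
  refine ⟨PiNat.firstDiff w w', ?_, le_dist_code (fun j => PiNat.apply_eq_of_lt_firstDiff)
    (PiNat.apply_firstDiff_ne (ne_of_apply_ne code hxy))⟩
  simp only [addrPrefix_eq_iff, address_code]
  exact fun j => PiNat.apply_eq_of_lt_firstDiff

/-- The word `u 0, …, u (k - 1), 0, 0, …`. -/
def padWord {k : ℕ} (u : Fin k → Fin 4) : ℕ → Fin 4 := fun j => if h : j < k then u ⟨j, h⟩ else 0

lemma padWord_of_lt {k j : ℕ} (u : Fin k → Fin 4) (hj : j < k) : padWord u j = u ⟨j, hj⟩ :=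
  dif_pos hj

lemma cantorMeasure_eq_map_code : cantorMeasure = wordMeasure.map code := by
  refine (eq_cantorMeasure (Measure.isProbabilityMeasure_map measurable_code.aemeasurable) ?_).symm
  have hcons (i : Fin 4) :
      (wordMeasure.map code).map (T i) = (wordMeasure.map (consWord i)).map code := by
    rw [Measure.map_map (measurable_T i) measurable_code,
      Measure.map_map measurable_code (measurable_consWord i)]
    exact congrArg (wordMeasure.map ·) (funext fun w => (code_consWord i w).symm)
  conv_rhs => rw [← wordMeasure_eq, Measure.map_finset_sum' measurable_code.aemeasurable]
  simp only [transfer, hcons, Measure.map_smul]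

lemma ae_mem_cantorSet : ∀ᵐ x ∂cantorMeasure, x ∈ cantorSet := by
  rw [cantorMeasure_eq_map_code]
  exact (ae_map_iff measurable_code.aemeasurable measurableSet_cantorSet).mpr
    (.of_forall Set.mem_range_self)

lemma unif4_singleton (a : Fin 4) : unif4 {a} = 1 / 4 := by
  rw [unif4, uniformOn_univ]
  simp

lemma cantorMeasure_addrPrefix (k : ℕ) (u : Fin k → Fin 4) :
    cantorMeasure.real (addrPrefix k ⁻¹' {u}) = (1 / 4) ^ k := by
  have hcylinder : code ⁻¹' (addrPrefix k ⁻¹' {u}) =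
      Set.pi (Finset.range k) fun j => {padWord u j} := by
    ext w
    simp +contextual only [Set.mem_preimage, Set.mem_singleton_iff, funext_iff, addrPrefix,
      address_code, Fin.forall_iff, Set.mem_pi, Finset.mem_coe, Finset.mem_range, padWord_of_lt]
  rw [measureReal_def, cantorMeasure_eq_map_code, Measure.map_apply measurable_code
    (measurable_addrPrefix k (measurableSet_singleton u)), hcylinder, wordMeasure,
    Measure.infinitePi_pi _ fun _ _ => measurableSet_singleton _]
  simp [unif4_singleton]

end Coding

section FiberDeviation

lemma integrable_comp_of_finite {α ι : Type*} [MeasurableSpace α] [Finite ι] [MeasurableSpace ι]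
    [MeasurableSingletonClass ι] {π : α → ι} {μ : Measure α} [IsFiniteMeasure μ]
    (hπ : Measurable π) (h : ι → ℝ) : Integrable (fun x => h (π x)) μ :=
  (Integrable.of_finite (f := h)).comp_measurable hπ

/-- The `ℓ¹` distance between the masses that two measures give to the fibres of a map with finitely
many values. -/
noncomputable def fiberDeviation {α ι : Type*} [MeasurableSpace α] [Fintype ι] (π : α → ι)
    (μ ν : Measure α) : ℝ :=
  ∑ u, |μ.real (π ⁻¹' {u}) - ν.real (π ⁻¹' {u})|

variable {α ι : Type*} [MeasurableSpace α] [Fintype ι] [MeasurableSpace ι]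
  [MeasurableSingletonClass ι] {π : α → ι} {μ ν : Measure α} [IsFiniteMeasure μ] [IsFiniteMeasure ν]

lemma integral_comp_eq_sum (hπ : Measurable π) (h : ι → ℝ) :
    ∫ x, h (π x) ∂μ = ∑ u, μ.real (π ⁻¹' {u}) * h u := by
  rw [← integral_map hπ.aemeasurable (measurable_of_countable h).aestronglyMeasurable,
    integral_fintype .of_finite]
  simp only [map_measureReal_apply hπ (measurableSet_singleton _), smul_eq_mul]

lemma integral_comp_sub_integral_comp (hπ : Measurable π) (h : ι → ℝ) :
    ∫ x, h (π x) ∂μ - ∫ x, h (π x) ∂ν =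
      ∑ u, (μ.real (π ⁻¹' {u}) - ν.real (π ⁻¹' {u})) * h u := by
  simp only [integral_comp_eq_sum hπ, ← Finset.sum_sub_distrib, sub_mul]

lemma abs_integral_comp_sub_integral_comp_le (hπ : Measurable π) {h : ι → ℝ} {B : ℝ}
    (hB : ∀ u, |h u| ≤ B) :
    |∫ x, h (π x) ∂μ - ∫ x, h (π x) ∂ν| ≤ B * fiberDeviation π μ ν := by
  rw [integral_comp_sub_integral_comp hπ, fiberDeviation, Finset.mul_sum]
  refine (Finset.abs_sum_le_sum_abs _ _).trans (Finset.sum_le_sum fun u _ => ?_)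
  rw [abs_mul, mul_comm]
  exact mul_le_mul_of_nonneg_right (hB u) (abs_nonneg _)

lemma exists_integral_comp_sub_eq_fiberDeviation (hπ : Measurable π) (μ ν : Measure α)
    [IsFiniteMeasure μ] [IsFiniteMeasure ν] :
    ∃ ε : ι → ℝ, (∀ u, |ε u| ≤ 1) ∧
      ∫ x, ε (π x) ∂μ - ∫ x, ε (π x) ∂ν = fiberDeviation π μ ν := by
  have hsign (s : SignType) : |(s : ℝ)| ≤ 1 := by cases s <;> simp
  let ε (u : ι) : ℝ := SignType.sign (μ.real (π ⁻¹' {u}) - ν.real (π ⁻¹' {u}))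
  refine ⟨ε, fun u => hsign _, (integral_comp_sub_integral_comp hπ ε).trans ?_⟩
  simp only [ε, self_mul_sign, fiberDeviation]

end FiberDeviation

section Comparison

variable {q : ℝ} {f : unitSquare → ℝ} {μ ν : Measure unitSquare}

lemma abs_sub_code_le_of_mem_Hol (hq : 0 ≤ q) (hf : f ∈ Hol q) {w w' : ℕ → Fin 4} {k : ℕ}
    (h : ∀ j < k, w j = w' j) : |f (code w) - f (code w')| ≤ 2 ^ q * ((1 / 4) ^ q) ^ k := by
  refine (mem_Hol.mp hf _ _).trans ((Real.rpow_le_rpow dist_nonneg (dist_code_le h) hq).trans_eq ?_)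
  rw [Real.mul_rpow (by norm_num) (by positivity), Real.rpow_pow_comm (by norm_num)]

lemma abs_integral_sub_integral_padWord_le [IsProbabilityMeasure μ] (hq : 0 < q) (hf : f ∈ Hol q)
    (hμ : ∀ᵐ x ∂μ, x ∈ cantorSet) (m : ℕ) :
    |∫ x, f x ∂μ - ∫ x, f (code (padWord (addrPrefix m x))) ∂μ| ≤
      2 ^ q * ((1 / 4) ^ q) ^ m := by
  rw [← integral_sub (integrable_of_mem_Hol hq hf)
    (integrable_comp_of_finite (measurable_addrPrefix m) fun u => f (code (padWord u))),
    ← Real.norm_eq_abs]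
  suffices h : ∀ᵐ x ∂μ, ‖f x - f (code (padWord (addrPrefix m x)))‖ ≤
      2 ^ q * ((1 / 4) ^ q) ^ m by
    simpa only [probReal_univ, mul_one] using norm_integral_le_of_norm_le_const h
  filter_upwards [hμ] with x hx
  have hpad : ∀ j < m, address x j = padWord (addrPrefix m x) j := fun j hj => by
    rw [padWord_of_lt _ hj, addrPrefix]
  simpa only [code_address hx, Real.norm_eq_abs] using abs_sub_code_le_of_mem_Hol hq.le hf hpad

variable [IsProbabilityMeasure μ] [IsProbabilityMeasure ν]

/- Passing from `m` to `m + 1` moves the sample point within its cylinder of level `m`, and the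
increment is a function of the cylinder of level `m + 1`. -/
lemma abs_integral_padWord_sub_integral_padWord_le (hq : 0 ≤ q) (hf : f ∈ Hol q) (m : ℕ) :
    |∫ x, f (code (padWord (addrPrefix m x))) ∂μ - ∫ x, f (code (padWord (addrPrefix m x))) ∂ν| ≤
      ∑ k ∈ Finset.range m,
        2 ^ q * ((1 / 4) ^ q) ^ k * fiberDeviation (addrPrefix (k + 1)) μ ν := by
  induction m with
  | zero =>
    have hconst (x : unitSquare) : addrPrefix 0 x = Fin.elim0 := Subsingleton.elim _ _
    simp [hconst]
  | succ m ih =>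
    let g (k : ℕ) (u : Fin k → Fin 4) : ℝ := f (code (padWord u))
    let increment (u : Fin (m + 1) → Fin 4) : ℝ := g (m + 1) u - g m fun j => u j.castSucc
    have hincrement (u) : |increment u| ≤ 2 ^ q * ((1 / 4) ^ q) ^ m := by
      refine abs_sub_code_le_of_mem_Hol hq hf fun j hj => ?_
      rw [padWord_of_lt _ hj, padWord_of_lt _ (hj.trans m.lt_succ_self)]
      rfl
    have hintegral (ρ : Measure unitSquare) [IsProbabilityMeasure ρ] :
        ∫ x, increment (addrPrefix (m + 1) x) ∂ρ =
          ∫ x, g (m + 1) (addrPrefix (m + 1) x) ∂ρ - ∫ x, g m (addrPrefix m x) ∂ρ :=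
      integral_sub (integrable_comp_of_finite (measurable_addrPrefix _) _)
        (integrable_comp_of_finite (measurable_addrPrefix _) _)
    have hstep := abs_integral_comp_sub_integral_comp_le (μ := μ) (ν := ν)
      (measurable_addrPrefix (m + 1)) hincrement
    rw [hintegral, hintegral] at hstep
    rw [Finset.sum_range_succ]
    refine le_trans (le_of_eq_of_le ?_ (abs_add_le _ _)) (add_le_add ih hstep)
    congr 1
    ring

lemma W_le_sum_fiberDeviation (hq : 0 < q) (hμ : ∀ᵐ x ∂μ, x ∈ cantorSet)
    (hν : ∀ᵐ x ∂ν, x ∈ cantorSet) (m : ℕ) :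
    W q μ ν ≤
      ∑ k ∈ Finset.range m, 2 ^ q * ((1 / 4) ^ q) ^ k * fiberDeviation (addrPrefix (k + 1)) μ ν +
        2 * (2 ^ q * ((1 / 4) ^ q) ^ m) := by
  refine W_le fun f hf => ?_
  have hμf := abs_le.mp (abs_integral_sub_integral_padWord_le hq hf hμ m)
  have hνf := abs_le.mp (abs_integral_sub_integral_padWord_le hq hf hν m)
  have hμν := abs_le.mp (abs_integral_padWord_sub_integral_padWord_le (μ := μ) (ν := ν) hq.le hf m)
  rw [abs_le]
  constructor <;> linarith

lemma abs_sum_range_le_pow_div {a : ℕ → ℝ} {c θ : ℝ} (hθ₀ : 0 ≤ θ) (hθ₁ : θ < 1) {k : ℕ}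
    (hzero : ∀ j < k, a j = 0) (ha : ∀ j, |a j| ≤ c * θ ^ j) (m : ℕ) :
    |∑ j ∈ Finset.range m, a j| ≤ c * (θ ^ k / (1 - θ)) := by
  have hc : 0 ≤ c := by simpa using (abs_nonneg _).trans (ha 0)
  have htail : ∑ j ∈ Finset.Ico k m, a j = ∑ j ∈ Finset.range m, a j := by
    refine Finset.sum_subset (fun j hj => Finset.mem_range.mpr (Finset.mem_Ico.mp hj).2)
      fun j hj hjk => hzero j ?_
    simp only [Finset.mem_range, Finset.mem_Ico] at hj hjk
    lia
  calc
    |∑ j ∈ Finset.range m, a j| ≤ ∑ j ∈ Finset.Ico k m, c * θ ^ j := by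
      rw [← htail]
      exact (Finset.abs_sum_le_sum_abs _ _).trans (Finset.sum_le_sum fun j _ => ha j)
    _ ≤ c * (θ ^ k / (1 - θ)) := by
      rw [← Finset.mul_sum]
      exact mul_le_mul_of_nonneg_left (geom_sum_Ico_le_of_lt_one hθ₀ hθ₁) hc

/-- The superposition, with weights `θ ^ k`, of functions `ε (k + 1)` of the cylinders of level
`k + 1`. -/
noncomputable def multiscaleSum (θ : ℝ) (ε : (k : ℕ) → (Fin k → Fin 4) → ℝ) (m : ℕ)
    (x : unitSquare) : ℝ :=
  ∑ k ∈ Finset.range m, θ ^ k * ε (k + 1) (addrPrefix (k + 1) x)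

lemma abs_multiscaleSum_sub_le {θ : ℝ} (hθ₀ : 0 ≤ θ) (hθ₁ : θ < 1)
    {ε : (k : ℕ) → (Fin k → Fin 4) → ℝ} (hε : ∀ k u, |ε k u| ≤ 1) {k : ℕ} {x y : unitSquare}
    (hxy : addrPrefix k x = addrPrefix k y) (m : ℕ) :
    |multiscaleSum θ ε m x - multiscaleSum θ ε m y| ≤ 2 * (θ ^ k / (1 - θ)) := by
  rw [multiscaleSum, multiscaleSum, ← Finset.sum_sub_distrib]
  refine abs_sum_range_le_pow_div hθ₀ hθ₁ (fun j hj => ?_) (fun j => ?_) m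
  · rw [addrPrefix_eq_iff] at hxy
    rw [addrPrefix_eq_iff.mpr fun i hi => hxy i (hi.trans_le hj), sub_self]
  · rw [← mul_sub, abs_mul, abs_of_nonneg (pow_nonneg hθ₀ j), mul_comm]
    refine mul_le_mul_of_nonneg_right ((abs_sub _ _).trans ?_) (pow_nonneg hθ₀ j)
    linarith [hε (j + 1) (addrPrefix (j + 1) x), hε (j + 1) (addrPrefix (j + 1) y)]

lemma exists_mem_Hol_eqOn_multiscaleSum (hq₀ : 0 < q) (hq₁ : q ≤ 1)
    {ε : (k : ℕ) → (Fin k → Fin 4) → ℝ} (hε : ∀ k u, |ε k u| ≤ 1) (m : ℕ) :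
    ∃ g ∈ Hol q, Set.EqOn
      (fun x => (1 - (1 / 4) ^ q) / 4 * multiscaleSum ((1 / 4) ^ q) ε m x) g cantorSet := by
  refine exists_mem_Hol_eqOn hq₀ hq₁ fun x hx y hy => ?_
  set θ : ℝ := (1 / 4) ^ q with hθ
  have hθ₀ : 0 ≤ θ := by positivity
  have hθ₁ : θ < 1 := Real.rpow_lt_one (by norm_num) (by norm_num) hq₀
  rcases eq_or_ne x y with rfl | hne
  · simpa using Real.rpow_nonneg (dist_nonneg (x := x) (y := x)) q
  obtain ⟨k, hk, hdist⟩ := exists_addrPrefix_eq_and_le_dist hx hy hne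
  have hhalf : (1 / 2 : ℝ) ≤ (1 / 2) ^ q := by
    simpa using Real.rpow_le_rpow_of_exponent_ge (x := 1 / 2) (by norm_num) (by norm_num) hq₁
  rw [← mul_sub, abs_mul, abs_of_pos (by linarith)]
  calc
    (1 - θ) / 4 * |multiscaleSum θ ε m x - multiscaleSum θ ε m y|
      ≤ (1 - θ) / 4 * (2 * (θ ^ k / (1 - θ))) :=
        mul_le_mul_of_nonneg_left (abs_multiscaleSum_sub_le hθ₀ hθ₁ hε hk m) (by linarith)
    _ = 1 / 2 * θ ^ k := by
      field_simp [(sub_pos.mpr hθ₁).ne']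
      ring
    _ ≤ (1 / 2) ^ q * θ ^ k := mul_le_mul_of_nonneg_right hhalf (pow_nonneg hθ₀ k)
    _ = (1 / 2 * (1 / 4) ^ k) ^ q := by
      rw [Real.mul_rpow (by norm_num) (by positivity), hθ, Real.rpow_pow_comm (by norm_num)]
    _ ≤ dist x y ^ q := Real.rpow_le_rpow (by positivity) hdist hq₀.le

lemma sum_fiberDeviation_le_W (hq₀ : 0 < q) (hq₁ : q ≤ 1) (hμ : ∀ᵐ x ∂μ, x ∈ cantorSet)
    (hν : ∀ᵐ x ∂ν, x ∈ cantorSet) (m : ℕ) :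
    (1 - (1 / 4) ^ q) / 4 *
      ∑ k ∈ Finset.range m, ((1 / 4) ^ q) ^ k * fiberDeviation (addrPrefix (k + 1)) μ ν ≤
        W q μ ν := by
  choose ε hε hεD using fun k =>
    exists_integral_comp_sub_eq_fiberDeviation (measurable_addrPrefix k) μ ν
  obtain ⟨g, hg, hgε⟩ := exists_mem_Hol_eqOn_multiscaleSum hq₀ hq₁ hε m
  have hintegral (ρ : Measure unitSquare) [IsProbabilityMeasure ρ] (hρ : ∀ᵐ x ∂ρ, x ∈ cantorSet) :
      ∫ x, g x ∂ρ = (1 - (1 / 4) ^ q) / 4 * ∑ k ∈ Finset.range m,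
        ((1 / 4) ^ q) ^ k * ∫ x, ε (k + 1) (addrPrefix (k + 1) x) ∂ρ := by
    rw [integral_congr_ae (hρ.mono fun x hx => (hgε hx).symm), integral_const_mul]
    simp only [multiscaleSum]
    rw [integral_finsetSum _ fun k _ =>
      (integrable_comp_of_finite (measurable_addrPrefix _) _).const_mul _]
    simp only [integral_const_mul]
  refine le_of_eq_of_le ?_ ((le_abs_self _).trans (abs_integral_sub_integral_le_W hq₀ hg))
  simp only [hintegral μ hμ, hintegral ν hν, ← mul_sub, ← Finset.sum_sub_distrib, hεD]

end Comparison

section CenteredIndicator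

variable {α Ω ι : Type*} [MeasurableSpace α] [MeasurableSpace Ω] {μ : Measure α}
  [IsProbabilityMeasure μ] {P : Measure Ω} {A : Set α} {X : ι → Ω → α}

/-- The indicator function of a set minus its mean. -/
noncomputable def centeredIndicator (μ : Measure α) (A : Set α) (x : α) : ℝ :=
  A.indicator 1 x - μ.real A

lemma measurable_centeredIndicator {μ : Measure α} (hA : MeasurableSet A) :
    Measurable (centeredIndicator μ A) :=
  (measurable_const.indicator hA).sub_const _

lemma abs_centeredIndicator_le_one (x : α) : |centeredIndicator μ A x| ≤ 1 := by
  have h₀ : 0 ≤ μ.real A := measureReal_nonneg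
  have h₁ : μ.real A ≤ 1 := measureReal_le_one
  rw [centeredIndicator, abs_le]
  by_cases hx : x ∈ A
  · rw [Set.indicator_of_mem hx, Pi.one_apply]
    constructor <;> linarith
  · rw [Set.indicator_of_notMem hx]
    constructor <;> linarith

lemma integral_centeredIndicator (hA : MeasurableSet A) : ∫ x, centeredIndicator μ A x ∂μ = 0 := by
  simp only [centeredIndicator]
  rw [integral_sub ((integrable_const 1).indicator hA) (integrable_const _),
    integral_indicator_one hA, integral_const, probReal_univ, one_smul, sub_self]

lemma integral_centeredIndicator_sq (hA : MeasurableSet A) :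
    ∫ x, centeredIndicator μ A x ^ 2 ∂μ = μ.real A * (1 - μ.real A) := by
  have hsq (x : α) : centeredIndicator μ A x ^ 2 =
      (1 - 2 * μ.real A) * A.indicator 1 x + μ.real A ^ 2 := by
    by_cases hx : x ∈ A
    · rw [centeredIndicator, Set.indicator_of_mem hx, Pi.one_apply]
      ring
    · rw [centeredIndicator, Set.indicator_of_notMem hx]
      ring
  simp only [hsq]
  rw [integral_add (((integrable_const 1).indicator hA).const_mul _) (integrable_const _),
    integral_const_mul, integral_indicator_one hA, integral_const, probReal_univ, one_smul]
  ring

lemma integral_centeredIndicator_comp (hX : ∀ i, HasLaw (X i) μ P) (hA : MeasurableSet A) (i : ι) :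
    ∫ ω, centeredIndicator μ A (X i ω) ∂P = 0 :=
  ((hX i).integral_comp (measurable_centeredIndicator hA).aestronglyMeasurable).trans
    (integral_centeredIndicator hA)

lemma integral_centeredIndicator_comp_sq (hX : ∀ i, HasLaw (X i) μ P) (hA : MeasurableSet A)
    (i : ι) : ∫ ω, centeredIndicator μ A (X i ω) ^ 2 ∂P = μ.real A * (1 - μ.real A) :=
  ((hX i).integral_comp (f := fun x => centeredIndicator μ A x ^ 2)
    ((measurable_centeredIndicator hA).pow_const 2).aestronglyMeasurable).trans
    (integral_centeredIndicator_sq hA)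

lemma memLp_centeredIndicator_comp [IsFiniteMeasure P] (hX : ∀ i, AEMeasurable (X i) P)
    (hA : MeasurableSet A) (i : ι) (p : ℝ≥0∞) :
    MemLp (fun ω => centeredIndicator μ A (X i ω)) p P :=
  .of_bound ((measurable_centeredIndicator hA).comp_aemeasurable (hX i)).aestronglyMeasurable 1
    (.of_forall fun ω => abs_centeredIndicator_le_one (X i ω))

variable [IsProbabilityMeasure P]

lemma sq_integral_abs_sum_centeredIndicator_le (hX : ∀ i, HasLaw (X i) μ P)
    (hind : Pairwise fun i j => IndepFun (X i) (X j) P) (hA : MeasurableSet A) (s : Finset ι) :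
    (∫ ω, |∑ i ∈ s, centeredIndicator μ A (X i ω)| ∂P) ^ 2 ≤
      s.card * (μ.real A * (1 - μ.real A)) := by
  have hmem (i : ι) := memLp_centeredIndicator_comp (μ := μ) (fun i => (hX i).aemeasurable) hA i 2
  have hm := measurable_centeredIndicator (μ := μ) hA
  refine (sq_integral_abs_le_integral_sq (memLp_finsetSum s fun i _ => hmem i)).trans_eq ?_
  rw [integral_sq_sum_of_pairwise_indepFun (fun i _ => hmem i)
    (fun i _ j _ hij => (hind hij).comp hm hm) fun i _ => integral_centeredIndicator_comp hX hA i]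
  simp only [integral_centeredIndicator_comp_sq hX hA, Finset.sum_const, nsmul_eq_mul]

lemma sq_le_mul_sq_integral_abs_sum_centeredIndicator (hX : ∀ i, HasLaw (X i) μ P)
    (hind : iIndepFun X P) (hA : MeasurableSet A) (s : Finset ι) :
    (s.card * (μ.real A * (1 - μ.real A))) ^ 2 ≤
      (1 + 3 * (s.card * (μ.real A * (1 - μ.real A)))) *
        (∫ ω, |∑ i ∈ s, centeredIndicator μ A (X i ω)| ∂P) ^ 2 := by
  have hm := measurable_centeredIndicator (μ := μ) hA
  have h := sq_sum_integral_sq_le (fun i => hm.comp_aemeasurable (hX i).aemeasurable)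
    (fun i => .of_forall fun ω => abs_centeredIndicator_le_one (X i ω))
    (hind.comp (fun _ => centeredIndicator μ A) fun _ => hm)
    (integral_centeredIndicator_comp hX hA) s
  simpa only [Function.comp_apply, integral_centeredIndicator_comp_sq hX hA, Finset.sum_const,
    nsmul_eq_mul] using h

end CenteredIndicator

section Empirical

variable {n : ℕ} {q : ℝ}

lemma isProbabilityMeasure_empirical (hn : n ≠ 0) (x : ℕ → unitSquare) :
    IsProbabilityMeasure (empirical n x) := by
  constructor
  simp only [empirical, Measure.smul_apply, Measure.finsetSum_apply, measure_univ,
    Finset.sum_const, Nat.card_Icc, smul_eq_mul, nsmul_eq_mul, mul_one, Nat.add_sub_cancel]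
  exact ENNReal.inv_mul_cancel (Nat.cast_ne_zero.mpr hn) (ENNReal.natCast_ne_top n)

lemma integral_empirical (n : ℕ) (x : ℕ → unitSquare) (f : unitSquare → ℝ) :
    ∫ y, f y ∂(empirical n x) = (n : ℝ)⁻¹ * ∑ k ∈ Finset.Icc 1 n, f (x k) := by
  rw [empirical, integral_smul_measure,
    integral_finsetSum_measure fun k _ => integrable_dirac enorm_lt_top]
  simp only [integral_dirac, ENNReal.toReal_inv, ENNReal.toReal_natCast, smul_eq_mul]

lemma ae_empirical {x : ℕ → unitSquare} {p : unitSquare → Prop} (h : ∀ k, p (x k)) :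
    ∀ᵐ y ∂(empirical n x), p y := by
  simp [ae_iff, empirical, h]

lemma empirical_real_sub (hn : n ≠ 0) (x : ℕ → unitSquare) {A : Set unitSquare}
    (hA : MeasurableSet A) (μ : Measure unitSquare) :
    (empirical n x).real A - μ.real A =
      (n : ℝ)⁻¹ * ∑ k ∈ Finset.Icc 1 n, centeredIndicator μ A (x k) := by
  simp only [centeredIndicator]
  rw [← integral_indicator_one hA, integral_empirical, Finset.sum_sub_distrib, Finset.sum_const,
    Nat.card_Icc, Nat.add_sub_cancel, nsmul_eq_mul, mul_sub,
    inv_mul_cancel_left₀ (Nat.cast_ne_zero.mpr hn)]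

lemma W_empirical_empirical_le (x y : ℕ → unitSquare) :
    W q (empirical n x) (empirical n y) ≤
      (n : ℝ)⁻¹ * ∑ k ∈ Finset.Icc 1 n, dist (x k) (y k) ^ q := by
  refine W_le fun f hf => ?_
  rw [integral_empirical, integral_empirical, ← mul_sub, ← Finset.sum_sub_distrib, abs_mul,
    abs_of_nonneg (by positivity)]
  gcongr
  exact (Finset.abs_sum_le_sum_abs _ _).trans (Finset.sum_le_sum fun k _ => mem_Hol.mp hf _ _)

lemma continuous_W_empirical (hq : 0 < q) (hn : n ≠ 0) (μ : Measure unitSquare)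
    [IsProbabilityMeasure μ] : Continuous fun x => W q (empirical n x) μ := by
  have hprob := isProbabilityMeasure_empirical hn
  refine continuous_iff_continuousAt.mpr fun y => tendsto_iff_dist_tendsto_zero.mpr ?_
  refine squeeze_zero (g := fun x => (n : ℝ)⁻¹ * ∑ k ∈ Finset.Icc 1 n, dist (x k) (y k) ^ q)
    (fun _ => dist_nonneg) (fun x => ?_) ?_
  · refine le_trans ?_ (W_empirical_empirical_le x y)
    have hxy := W_triangle hq (μ := empirical n x) (ν := empirical n y) (ρ := μ)
    have hyx := W_triangle hq (μ := empirical n y) (ν := empirical n x) (ρ := μ)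
    rw [W_comm (μ := empirical n y) (ν := empirical n x)] at hyx
    rw [Real.dist_eq, abs_sub_le_iff]
    constructor <;> linarith
  · rw [← mul_zero (n : ℝ)⁻¹, ← Finset.sum_const_zero (s := Finset.Icc 1 n)]
    exact (tendsto_finsetSum _ fun k _ =>
      (tendsto_dist_rpow hq (y k)).comp ((continuous_apply k).tendsto y)).const_mul _

variable {Ω : Type*} [MeasurableSpace Ω] {P : Measure Ω} {X : ℕ → Ω → unitSquare}
  {μ : Measure unitSquare} {A : Set unitSquare}

lemma integral_abs_empirical_real_sub (hn : n ≠ 0) (hA : MeasurableSet A) :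
    ∫ ω, |(empirical n fun k => X k ω).real A - μ.real A| ∂P =
      (n : ℝ)⁻¹ * ∫ ω, |∑ k ∈ Finset.Icc 1 n, centeredIndicator μ A (X k ω)| ∂P := by
  simp only [empirical_real_sub hn _ hA, abs_mul, integral_const_mul]
  rw [abs_of_nonneg (by positivity)]

variable [IsProbabilityMeasure μ]

lemma integrable_W_empirical [IsFiniteMeasure P] (hq : 0 < q) (hn : n ≠ 0)
    (hX : ∀ k, AEMeasurable (X k) P) :
    Integrable (fun ω => W q (empirical n fun k => X k ω) μ) P := by
  have hmeas : AEMeasurable (fun ω => W q (empirical n fun k => X k ω) μ) P :=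
    (continuous_W_empirical hq hn μ).measurable.comp_aemeasurable (aemeasurable_pi_lambda _ hX)
  refine .of_bound hmeas.aestronglyMeasurable (2 ^ q) (.of_forall fun ω => ?_)
  have := isProbabilityMeasure_empirical hn fun k => X k ω
  rw [Real.norm_of_nonneg W_nonneg]
  exact W_le_two_rpow hq

lemma integrable_abs_empirical_real_sub [IsFiniteMeasure P] (hn : n ≠ 0)
    (hX : ∀ k, AEMeasurable (X k) P) (hA : MeasurableSet A) :
    Integrable (fun ω => |(empirical n fun k => X k ω).real A - μ.real A|) P := by
  simp only [empirical_real_sub hn _ hA]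
  exact ((integrable_finsetSum _ fun k _ =>
    (memLp_centeredIndicator_comp hX hA k 1).integrable le_rfl).const_mul _).abs

variable [IsProbabilityMeasure P]

lemma sq_integral_abs_empirical_real_sub_le (hX : ∀ k, HasLaw (X k) μ P)
    (hind : Pairwise fun i j => IndepFun (X i) (X j) P) (hn : n ≠ 0) (hA : MeasurableSet A) :
    (∫ ω, |(empirical n fun k => X k ω).real A - μ.real A| ∂P) ^ 2 ≤ μ.real A / n := by
  have hn₀ : (0 : ℝ) < n := mod_cast hn.bot_lt
  have h := sq_integral_abs_sum_centeredIndicator_le hX hind hA (Finset.Icc 1 n)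
  rw [Nat.card_Icc, Nat.add_sub_cancel] at h
  rw [integral_abs_empirical_real_sub hn hA, mul_pow, inv_pow, inv_mul_le_iff₀ (by positivity)]
  refine h.trans ?_
  have hp : μ.real A * (1 - μ.real A) ≤ μ.real A :=
    mul_le_of_le_one_right measureReal_nonneg (by linarith [measureReal_nonneg (μ := μ) (s := A)])
  calc
    n * (μ.real A * (1 - μ.real A)) ≤ n * μ.real A := mul_le_mul_of_nonneg_left hp hn₀.le
    _ = n ^ 2 * (μ.real A / n) := by field_simp

lemma le_sq_integral_abs_empirical_real_sub (hX : ∀ k, HasLaw (X k) μ P) (hind : iIndepFun X P)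
    (hn : n ≠ 0) (hA : MeasurableSet A) (hp : μ.real A ≤ 1 / 4) (hnp : 1 / 4 ≤ n * μ.real A) :
    μ.real A / n / 16 ≤
      (∫ ω, |(empirical n fun k => X k ω).real A - μ.real A| ∂P) ^ 2 := by
  have : (0 : ℝ) < n := mod_cast hn.bot_lt
  have h := sq_le_mul_sq_integral_abs_sum_centeredIndicator hX hind hA (Finset.Icc 1 n)
  rw [Nat.card_Icc, Nat.add_sub_cancel] at h
  rw [integral_abs_empirical_real_sub hn hA, mul_pow, inv_pow, le_inv_mul_iff₀ (by positivity)]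
  set p := μ.real A
  set S := (∫ ω, |∑ k ∈ Finset.Icc 1 n, centeredIndicator μ A (X k ω)| ∂P) ^ 2
  have hV : 3 / 4 * (n * p) ≤ n * (p * (1 - p)) := by nlinarith
  set V := n * (p * (1 - p))
  have hS : 3 / 25 * V ≤ S := by
    have hV₀ : 0 < 1 + 3 * V := by linarith
    refine le_of_mul_le_mul_left (le_trans ?_ h) hV₀
    nlinarith
  calc
    (n : ℝ) ^ 2 * (p / n / 16) = n * p / 16 := by field_simp
    _ ≤ S := by linarith

end Empirical

section Expectation

variable {Ω : Type*} [MeasurableSpace Ω] {P : Measure Ω} {X : ℕ → Ω → unitSquare} {n : ℕ} {q : ℝ}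

lemma ae_ae_empirical_mem_cantorSet (hX : ∀ k, HasLaw (X k) cantorMeasure P) :
    ∀ᵐ ω ∂P, ∀ᵐ x ∂(empirical n fun k => X k ω), x ∈ cantorSet := by
  have hmem : ∀ᵐ ω ∂P, ∀ k, X k ω ∈ cantorSet :=
    ae_all_iff.mpr fun k =>
      ((hX k).ae_iff (measurable_mem.mpr measurableSet_cantorSet)).mpr ae_mem_cantorSet
  exact hmem.mono fun ω hω => ae_empirical hω

lemma integrable_fiberDeviation_empirical [IsFiniteMeasure P] (hX : ∀ k, AEMeasurable (X k) P)
    (hn : n ≠ 0) (k : ℕ) :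
    Integrable (fun ω =>
      fiberDeviation (addrPrefix k) (empirical n fun j => X j ω) cantorMeasure) P :=
  integrable_finsetSum _ fun _ _ => integrable_abs_empirical_real_sub hn hX
    (measurable_addrPrefix k (measurableSet_singleton _))

lemma sum_const_half_pow (k : ℕ) (c : ℝ) : ∑ _u : Fin k → Fin 4, (1 / 2) ^ k * c = 2 ^ k * c := by
  rw [Finset.sum_const, Finset.card_univ, Fintype.card_fun, Fintype.card_fin, Fintype.card_fin,
    nsmul_eq_mul, Nat.cast_pow, ← mul_assoc, ← mul_pow]
  norm_num

variable [IsProbabilityMeasure P]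

lemma integral_fiberDeviation_empirical (hX : ∀ k, AEMeasurable (X k) P) (hn : n ≠ 0) (k : ℕ) :
    ∫ ω, fiberDeviation (addrPrefix k) (empirical n fun j => X j ω) cantorMeasure ∂P =
      ∑ u, ∫ ω, |(empirical n fun j => X j ω).real (addrPrefix k ⁻¹' {u}) -
        cantorMeasure.real (addrPrefix k ⁻¹' {u})| ∂P :=
  integral_finsetSum _ fun _ _ => integrable_abs_empirical_real_sub hn hX
    (measurable_addrPrefix k (measurableSet_singleton _))

lemma quarter_pow_div_eq_sq (k n : ℕ) : (1 / 4 : ℝ) ^ k / n = ((1 / 2) ^ k * (1 / √n)) ^ 2 := by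
  rw [mul_pow, ← pow_mul, mul_comm k, pow_mul, one_div_pow _ 2, one_div_pow _ 2,
    Real.sq_sqrt n.cast_nonneg]
  norm_num
  ring

lemma integral_fiberDeviation_empirical_le (hX : ∀ k, HasLaw (X k) cantorMeasure P)
    (hind : Pairwise fun i j => IndepFun (X i) (X j) P) (hn : n ≠ 0) (k : ℕ) :
    ∫ ω, fiberDeviation (addrPrefix k) (empirical n fun j => X j ω) cantorMeasure ∂P ≤
      2 ^ k * (1 / √n) := by
  rw [integral_fiberDeviation_empirical (fun k => (hX k).aemeasurable) hn, ← sum_const_half_pow]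
  refine Finset.sum_le_sum fun u _ => le_of_sq_le_sq ?_ (by positivity)
  have h := sq_integral_abs_empirical_real_sub_le hX hind hn
    (measurable_addrPrefix k (measurableSet_singleton u))
  rw [cantorMeasure_addrPrefix, quarter_pow_div_eq_sq] at h
  rwa [cantorMeasure_addrPrefix]

lemma le_integral_fiberDeviation_empirical (hX : ∀ k, HasLaw (X k) cantorMeasure P)
    (hind : iIndepFun X P) (hn : n ≠ 0) {k : ℕ} (hk : k ≠ 0) (hkn : 4 ^ k ≤ 4 * n) :
    2 ^ k * (1 / √n / 4) ≤
      ∫ ω, fiberDeviation (addrPrefix k) (empirical n fun j => X j ω) cantorMeasure ∂P := by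
  rw [integral_fiberDeviation_empirical (fun k => (hX k).aemeasurable) hn, ← sum_const_half_pow]
  refine Finset.sum_le_sum fun u _ => le_of_sq_le_sq ?_ (integral_nonneg fun ω => abs_nonneg _)
  have hp : (1 / 4 : ℝ) ^ k ≤ 1 / 4 := pow_le_of_le_one (by norm_num) (by norm_num) hk
  have hnp : (1 / 4 : ℝ) ≤ n * (1 / 4) ^ k := by
    have hkn' : (4 : ℝ) ^ k ≤ 4 * n := mod_cast hkn
    rw [one_div_pow, mul_one_div, le_div_iff₀ (by positivity)]
    linarith
  rw [← cantorMeasure_addrPrefix k u] at hp hnp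
  have h := le_sq_integral_abs_empirical_real_sub hX hind hn
    (measurable_addrPrefix k (measurableSet_singleton u)) hp hnp
  rw [cantorMeasure_addrPrefix, quarter_pow_div_eq_sq] at h
  rw [cantorMeasure_addrPrefix]
  refine le_of_eq_of_le ?_ h
  ring

lemma integral_W_empirical_le (hq : 0 < q) (hX : ∀ k, HasLaw (X k) cantorMeasure P)
    (hind : Pairwise fun i j => IndepFun (X i) (X j) P) (hn : n ≠ 0) (m : ℕ) :
    ∫ ω, W q (empirical n fun k => X k ω) cantorMeasure ∂P ≤
      2 ^ q * (2 * (∑ k ∈ Finset.range m, (2 * (1 / 4) ^ q) ^ k) / √n +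
        2 * ((1 / 4) ^ q) ^ m) := by
  have hprob (ω : Ω) := isProbabilityMeasure_empirical hn fun k => X k ω
  have hXm (k : ℕ) := (hX k).aemeasurable
  have hD (k : ℕ) (_ : k ∈ Finset.range m) :=
    (integrable_fiberDeviation_empirical hXm hn (k + 1)).const_mul (2 ^ q * ((1 / 4) ^ q) ^ k)
  calc
    ∫ ω, W q (empirical n fun k => X k ω) cantorMeasure ∂P
      ≤ ∫ ω, (∑ k ∈ Finset.range m, 2 ^ q * ((1 / 4) ^ q) ^ k *
          fiberDeviation (addrPrefix (k + 1)) (empirical n fun j => X j ω) cantorMeasure +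
            2 * (2 ^ q * ((1 / 4) ^ q) ^ m)) ∂P := by
        refine integral_mono_ae (integrable_W_empirical hq hn hXm)
          ((integrable_finsetSum _ hD).add (integrable_const _)) ?_
        filter_upwards [ae_ae_empirical_mem_cantorSet hX] with ω hω
        exact W_le_sum_fiberDeviation hq hω ae_mem_cantorSet m
    _ = ∑ k ∈ Finset.range m, 2 ^ q * ((1 / 4) ^ q) ^ k *
          ∫ ω, fiberDeviation (addrPrefix (k + 1)) (empirical n fun j => X j ω) cantorMeasure ∂P +
            2 * (2 ^ q * ((1 / 4) ^ q) ^ m) := by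
        rw [integral_add (integrable_finsetSum _ hD) (integrable_const _),
          integral_finsetSum _ hD, integral_const, probReal_univ, one_smul]
        simp only [integral_const_mul]
    _ ≤ ∑ k ∈ Finset.range m, 2 ^ q * ((1 / 4) ^ q) ^ k * (2 ^ (k + 1) * (1 / √n)) +
            2 * (2 ^ q * ((1 / 4) ^ q) ^ m) := by
        gcongr with k
        exact integral_fiberDeviation_empirical_le hX hind hn (k + 1)
    _ = _ := by
        simp only [Finset.mul_sum, Finset.sum_div, mul_add, mul_pow]
        congr 1
        · exact Finset.sum_congr rfl fun k _ => by ring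
        · ring

lemma le_integral_W_empirical (hq₀ : 0 < q) (hq₁ : q ≤ 1) (hX : ∀ k, HasLaw (X k) cantorMeasure P)
    (hind : iIndepFun X P) (hn : n ≠ 0) {m : ℕ} (hm : 4 ^ m ≤ 4 * n) :
    (1 - (1 / 4) ^ q) / 8 * (∑ k ∈ Finset.range m, (2 * (1 / 4) ^ q) ^ k) / √n ≤
      ∫ ω, W q (empirical n fun k => X k ω) cantorMeasure ∂P := by
  have hprob (ω : Ω) := isProbabilityMeasure_empirical hn fun k => X k ω
  have hXm (k : ℕ) := (hX k).aemeasurable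
  have hD (k : ℕ) (_ : k ∈ Finset.range m) :=
    (integrable_fiberDeviation_empirical hXm hn (k + 1)).const_mul (((1 / 4) ^ q) ^ k)
  have hθ : (1 / 4 : ℝ) ^ q ≤ 1 := Real.rpow_le_one (by norm_num) (by norm_num) hq₀.le
  calc
    _ = (1 - (1 / 4) ^ q) / 4 *
          ∑ k ∈ Finset.range m, ((1 / 4) ^ q) ^ k * (2 ^ (k + 1) * (1 / √n / 4)) := by
        simp only [Finset.mul_sum, Finset.sum_div, mul_pow]
        exact Finset.sum_congr rfl fun k _ => by ring
    _ ≤ (1 - (1 / 4) ^ q) / 4 * ∑ k ∈ Finset.range m, ((1 / 4) ^ q) ^ k *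
          ∫ ω, fiberDeviation (addrPrefix (k + 1)) (empirical n fun j => X j ω)
            cantorMeasure ∂P := by
        gcongr with k hk
        exact le_integral_fiberDeviation_empirical hX hind hn k.succ_ne_zero
          ((Nat.pow_le_pow_right four_pos (Finset.mem_range.mp hk)).trans hm)
    _ = ∫ ω, (1 - (1 / 4) ^ q) / 4 * ∑ k ∈ Finset.range m, ((1 / 4) ^ q) ^ k *
          fiberDeviation (addrPrefix (k + 1)) (empirical n fun j => X j ω) cantorMeasure ∂P := by
        rw [integral_const_mul, integral_finsetSum _ hD]
        simp only [integral_const_mul]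
    _ ≤ ∫ ω, W q (empirical n fun k => X k ω) cantorMeasure ∂P := by
        refine integral_mono_ae ((integrable_finsetSum _ hD).const_mul _)
          (integrable_W_empirical hq₀ hn hXm) ?_
        filter_upwards [ae_ae_empirical_mem_cantorSet hX] with ω hω
        exact sum_fiberDeviation_le_W hq₀ hq₁ hω ae_mem_cantorSet m

end Expectation

section CriticalExponent

lemma quarter_rpow_half : (1 / 4 : ℝ) ^ (1 / 2 : ℝ) = 1 / 2 := by
  rw [← Real.sqrt_eq_rpow, show (1 / 4 : ℝ) = (1 / 2) ^ 2 by norm_num,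
    Real.sqrt_sq (by norm_num)]

lemma log_four : Real.log 4 = 2 * Real.log 2 := by
  rw [show (4 : ℝ) = 2 ^ 2 by norm_num, Real.log_pow, Nat.cast_ofNat]

lemma log_le_natLog_four_add_one {n : ℕ} (hn : n ≠ 0) : Real.log n ≤ 2 * (Nat.log 4 n + 1) := by
  have h : Real.log n ≤ Real.log (4 ^ (Nat.log 4 n + 1)) :=
    Real.log_le_log (by positivity) (mod_cast (Nat.lt_pow_succ_log_self (by norm_num) n).le)
  rw [Real.log_pow, log_four, Nat.cast_succ] at h
  nlinarith [Real.log_two_lt_d9]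

lemma natLog_four_add_two_le {n : ℕ} (hn : 2 ≤ n) : Nat.log 4 n + 2 ≤ 5 * Real.log n := by
  have h : Real.log (4 ^ Nat.log 4 n) ≤ Real.log n :=
    Real.log_le_log (by positivity) (mod_cast Nat.pow_log_le_self 4 (by omega))
  have h₂ : Real.log 2 ≤ Real.log n := Real.log_le_log two_pos (mod_cast hn)
  rw [Real.log_pow, log_four] at h
  nlinarith [Real.log_two_gt_d9, (Nat.log 4 n).cast_nonneg (α := ℝ)]

variable {Ω : Type*} [MeasurableSpace Ω] {P : Measure Ω} [IsProbabilityMeasure P]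
  {X : ℕ → Ω → unitSquare} {n : ℕ}

lemma integral_W_half_empirical_le (hX : ∀ k, HasLaw (X k) cantorMeasure P)
    (hind : Pairwise fun i j => IndepFun (X i) (X j) P) (hn : n ≠ 0) {m : ℕ} (hm : n ≤ 4 ^ m) :
    ∫ ω, W (1 / 2) (empirical n fun k => X k ω) cantorMeasure ∂P ≤ 4 * ((m + 1) / √n) := by
  have h := integral_W_empirical_le (q := 1 / 2) (by norm_num) hX hind hn m
  have hroot : (2 : ℝ) ^ (1 / 2 : ℝ) ≤ 2 := Real.rpow_le_self_of_one_le one_le_two (by norm_num)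
  have hpow : (1 / 2 : ℝ) ^ m ≤ 1 / √n := by
    rw [one_div_pow]
    refine one_div_le_one_div_of_le (by positivity) (Real.sqrt_le_iff.mpr ⟨by positivity, ?_⟩)
    rw [← pow_mul, mul_comm, pow_mul]
    exact_mod_cast hm
  simp only [quarter_rpow_half, mul_one_div_cancel (two_ne_zero' ℝ), one_pow, Finset.sum_const,
    Finset.card_range, nsmul_one] at h
  calc
    _ ≤ (2 : ℝ) ^ (1 / 2 : ℝ) * (2 * m / √n + 2 * (1 / 2) ^ m) := h
    _ ≤ 2 * (2 * m / √n + 2 * (1 / √n)) := by gcongr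
    _ = 4 * ((m + 1) / √n) := by ring

lemma le_integral_W_half_empirical (hX : ∀ k, HasLaw (X k) cantorMeasure P)
    (hind : iIndepFun X P) (hn : n ≠ 0) {m : ℕ} (hm : 4 ^ m ≤ 4 * n) :
    1 / 16 * (m / √n) ≤ ∫ ω, W (1 / 2) (empirical n fun k => X k ω) cantorMeasure ∂P := by
  have h := le_integral_W_empirical (q := 1 / 2) (by norm_num) (by norm_num) hX hind hn hm
  simp only [quarter_rpow_half, mul_one_div_cancel (two_ne_zero' ℝ), one_pow, Finset.sum_const,
    Finset.card_range, nsmul_one] at h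
  refine le_of_eq_of_le ?_ h
  ring

end CriticalExponent

end FourCorners

theorem mainTheorem7 :
    ∃ c C : ℝ, 0 < c ∧ 0 < C ∧
      ∀ (Ω : Type*) [MeasurableSpace Ω] (P : Measure Ω) [IsProbabilityMeasure P]
        (X : ℕ → Ω → FourCorners.unitSquare),
        (∀ k, HasLaw (X k) FourCorners.cantorMeasure P) → iIndepFun X P →
        ∀ n : ℕ, 2 ≤ n →
          Integrable (fun ω => FourCorners.W (1 / 2)
            (FourCorners.empirical n (fun k => X k ω)) FourCorners.cantorMeasure) P ∧
          c * (Real.log n / √n) ≤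
            ∫ ω, FourCorners.W (1 / 2)
              (FourCorners.empirical n (fun k => X k ω)) FourCorners.cantorMeasure ∂P ∧
          ∫ ω, FourCorners.W (1 / 2)
              (FourCorners.empirical n (fun k => X k ω)) FourCorners.cantorMeasure ∂P ≤
            C * (Real.log n / √n) := by
  refine ⟨1 / 32, 20, by norm_num, by norm_num, fun Ω _ P _ X hX hind n hn => ?_⟩
  have hn₀ : n ≠ 0 := by omega
  set m := Nat.log 4 n + 1 with hm
  have hlower : 4 ^ m ≤ 4 * n := by
    rw [hm, pow_succ']
    exact Nat.mul_le_mul_left 4 (Nat.pow_log_le_self 4 hn₀)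
  have hupper : n ≤ 4 ^ m := (Nat.lt_pow_succ_log_self (by norm_num) n).le
  refine ⟨FourCorners.integrable_W_empirical (by norm_num) hn₀ fun k => (hX k).aemeasurable, ?_, ?_⟩
  · calc
      1 / 32 * (Real.log n / √n) ≤ 1 / 32 * (2 * m / √n) := by
        gcongr
        exact_mod_cast FourCorners.log_le_natLog_four_add_one hn₀
      _ = 1 / 16 * (m / √n) := by ring
      _ ≤ _ := FourCorners.le_integral_W_half_empirical hX hind hn₀ hlower
  · calc
      _ ≤ 4 * ((m + 1) / √n) := FourCorners.integral_W_half_empirical_le hX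
        (fun i j hij => hind.indepFun hij) hn₀ hupper
      _ ≤ 4 * (5 * Real.log n / √n) := by
        gcongr
        rw [hm, Nat.cast_succ]
        linarith [FourCorners.natLog_four_add_two_le hn]
      _ = 20 * (Real.log n / √n) := by ring
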